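/- Let $E,H$ be real Hilbert spaces, let $r,s,\sigma>0$, and put $B_r=\{x\in E:\|x\|\le r\}$. Let $P:E\to\mathbb R$ be an even $C^1$ functional such that the restriction to $B_r$ of $x\mapsto\sigma\|x\|^2-P(x)$ is sequentially weakly lower semicontinuous, and let $\psi:E\to H$ be an odd $C^1$ operator which is sequentially weakly continuous (i.e. $x_n\rightharpoonup x$ in $E$ implies $\psi(x_n)\rightharpoonup\psi(x)$ in $H$). Derivatives of real functionals on $E$ are identified with elements of $E$ by the Riesz theorem. Let $M\ge 0$ and let $\lambda$ satisfy $$0<\lambda\le\min\left\{\frac{r}{\sup_{x\in B_r}\left(\|P'(x)\|+s\|\psi'(x)\|_{\mathcal L(E,H)}\right)+M},\ \frac1{2\sigma}\right\}$$ (the first quotient being $0$ if the supremum is infinite). Suppose that the restriction to $B_r$ of the functional $x\mapsto\frac1{2\lambda}\|x\|^2-P(x)$ has no global minimum at which $\psi$ vanishes, i.e. no $x_0\in B_r$ minimizing it over $B_r$ satisfies $\psi(x_0)=0$. Then there exists $\delta^*>0$ such that, for every convex set $S\subseteq H$ dense in $H$ and every $C^1$ functional $\gamma:E\to\mathbb R$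 satisfying $$\sup_{B_r}\gamma-\inf_{B_r}\gamma<\delta^*,\qquad \sup_{x\in B_r}\|\gamma'(x)\|\le M,$$ and such that the restriction to $B_r$ of $x\mapsto\sigma\|x\|^2-P(x)-\gamma(x)$ is sequentially weakly lower semicontinuous, there exists $\tilde y\in S$ with $\|\tilde y\|_H<s$ such that the equation $$x=\lambda\left(P'(x)+\gamma'(x)+\frac{d}{dx}\langle\psi(x),\tilde y\rangle_H\right)$$ has at least two distinct solutions in $B_r$. -/

import Mathlib

open Filter Topology

open scoped Gradient

/-- Weak convergence of a sequence `u` to `x` in a real normed space. -/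
def WeaklyTendsto {E : Type*} [NormedAddCommGroup E] [NormedSpace ℝ E]
    (u : ℕ → E) (x : E) : Prop :=
  Tendsto (fun n => toWeakSpace ℝ E (u n)) atTop (𝓝 (toWeakSpace ℝ E x))

/-- The restriction of `f` to `X` is sequentially weakly lower semicontinuous: whenever a sequence
in `X` converges weakly to a point `x ∈ X`, one has `f x ≤ liminf f (u n)`, the liminf being taken
in the extended reals. -/
def SeqWeaklyLowerSemicontinuousOn {E : Type*} [NormedAddCommGroup E] [NormedSpace ℝ E]
    (f : E → ℝ) (X : Set E) : Prop :=
  ∀ (u : ℕ → E) (x : E), (∀ n, u n ∈ X) → x ∈ X → WeaklyTendsto u x →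
    ∀ c < f x, ∀ᶠ n in atTop, c < f (u n)

/-- `ψ` is sequentially weakly continuous: it maps weakly convergent sequences to weakly convergent
sequences (weak topology both in the domain and in the codomain). -/
def SeqWeaklyContinuous {E H : Type*} [NormedAddCommGroup E] [NormedSpace ℝ E]
    [NormedAddCommGroup H] [NormedSpace ℝ H] (ψ : E → H) : Prop :=
  ∀ (u : ℕ → E) (x : E), WeaklyTendsto u x → WeaklyTendsto (fun n => ψ (u n)) (ψ x)

/-! Put I = ‖·‖²/(2 lam) − P and J = I − γ on the ball. Since I is even and ψ is odd, for each y one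
of ±x₀, with x₀ minimizing I, gives J − ⟪ψ, y⟫ ≤ min I − inf γ; so sup over y of inf over x is at
most this. In the other order, the supremum over ‖y‖ < s is J + s‖ψ‖, which is at least min(I +
s‖ψ‖) − sup γ. As no minimizer of I is a zero of ψ, δ = min(I + s‖ψ‖) − min I is positive, and
oscillation of γ below δ leaves a minimax gap.

If every J − ⟪ψ, y⟫ with y in S and ‖y‖ < s had a unique minimizer,
`exists_forall_le_of_unique_minimizer` on the weakly compact ball would close the gap. So some y has
two minimizers. Both solve the equation, even on the sphere: the bound on lam keeps lam times the
gradient in the ball (`IsMinOn.eq_smul_gradient`). -/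

section WeakTopology

/-! ### Weak compactness of balls and weak lower semicontinuity. -/

variable {E : Type*} [NormedAddCommGroup E] [InnerProductSpace ℝ E]

/-- The closed ball of radius `r` around the origin, as a subset of the weak space. -/
def weakClosedBall (E : Type*) [NormedAddCommGroup E] [NormedSpace ℝ E] (r : ℝ) :
    Set (WeakSpace ℝ E) :=
  (toWeakSpace ℝ E).symm ⁻¹' Metric.closedBall (0 : E) r

theorem continuous_inner_toWeakSpace_symm (v : E) :
    Continuous fun x : WeakSpace ℝ E => inner ℝ v ((toWeakSpace ℝ E).symm x) :=
  WeakBilin.eval_continuous (topDualPairing ℝ E).flip (innerSL ℝ v)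

theorem WeaklyTendsto.tendsto_inner {u : ℕ → E} {x : E} (h : WeaklyTendsto u x) (v : E) :
    Tendsto (fun n => inner ℝ v (u n)) atTop (𝓝 (inner ℝ v x)) :=
  ((continuous_inner_toWeakSpace_symm v).tendsto _).comp h

/-- Banach–Alaoglu, transported through the Riesz isomorphism. -/
theorem isCompact_weakClosedBall [CompleteSpace E] (r : ℝ) :
    IsCompact (weakClosedBall E r) := by
  have hc : Continuous fun φ : WeakDual ℝ E =>
      toWeakSpace ℝ E ((InnerProductSpace.toDual ℝ E).symm (WeakDual.toStrongDual φ)) := by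
    refine WeakBilin.continuous_of_continuous_eval _ fun y => ?_
    have : ∀ φ : WeakDual ℝ E, (topDualPairing ℝ E).flip
        (toWeakSpace ℝ E ((InnerProductSpace.toDual ℝ E).symm (WeakDual.toStrongDual φ))) y =
        φ ((InnerProductSpace.toDual ℝ E).symm y) := by
      intro φ
      change y ((InnerProductSpace.toDual ℝ E).symm (WeakDual.toStrongDual φ)) = _
      rw [← InnerProductSpace.toDual_symm_apply, real_inner_comm,
        InnerProductSpace.toDual_symm_apply]
      rfl
    exact (WeakDual.eval_continuous ((InnerProductSpace.toDual ℝ E).symm y)).congr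
      fun φ => (this φ).symm
  have himg := (WeakDual.isCompact_closedBall (𝕜 := ℝ) (0 : StrongDual ℝ E) r).image hc
  convert! himg using 1
  ext z
  constructor
  · intro hz
    refine ⟨StrongDual.toWeakDual
      (InnerProductSpace.toDual ℝ E ((toWeakSpace ℝ E).symm z)), ?_, ?_⟩
    · simpa [weakClosedBall] using hz
    · simp
  · rintro ⟨φ, hφ, rfl⟩
    simpa [weakClosedBall] using hφ

/-- A point of a ball at which `p` holds frequently for the weak topology is the weak limit of a
sequence in the ball satisfying `p`. -/
theorem exists_weaklyTendsto_of_frequently [CompleteSpace E] {r : ℝ} {p : E → Prop} {x : E}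
    (h : ∃ᶠ z in 𝓝[weakClosedBall E r] (toWeakSpace ℝ E x), p ((toWeakSpace ℝ E).symm z)) :
    ∃ u : ℕ → E, (∀ n, u n ∈ Metric.closedBall (0 : E) r ∧ p (u n)) ∧ WeaklyTendsto u x := by
  have near : ∀ (v : E) (ε : ℝ), 0 < ε → ∀ᶠ z in 𝓝[weakClosedBall E r] (toWeakSpace ℝ E x),
      |inner ℝ v ((toWeakSpace ℝ E).symm z) - inner ℝ v x| < ε := by
    intro v ε hε
    have := ((continuous_inner_toWeakSpace_symm v).tendsto (toWeakSpace ℝ E x)).mono_left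
      (nhdsWithin_le_nhds (s := weakClosedBall E r))
    simpa [Real.dist_eq] using this.eventually (Metric.ball_mem_nhds _ hε)
  -- Each new point is tested, with shrinking tolerance, against x and all earlier points; the index
  -- in the pair carries the tolerance.
  obtain ⟨f, hf, hfr⟩ := exists_seq_of_forall_finset_exists
    (fun q : E × ℕ => (q.1 ∈ Metric.closedBall (0 : E) r ∧ p q.1) ∧
      |inner ℝ x q.1 - inner ℝ x x| < 1 / ((q.2 : ℝ) + 1))
    (fun q q' => q.2 < q'.2 ∧ |inner ℝ q.1 q'.1 - inner ℝ q.1 x| < 1 / ((q'.2 : ℝ) + 1))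
    (by
      intro F _
      obtain ⟨N, hN⟩ : ∃ N, ∀ q ∈ F, q.2 < N :=
        ⟨F.sup Prod.snd + 1, fun q hq => Nat.lt_succ_of_le (Finset.le_sup (f := Prod.snd) hq)⟩
      have hpos : (0 : ℝ) < 1 / ((N : ℝ) + 1) := Nat.one_div_pos_of_nat
      have hall := (F.eventually_all (p := fun q z =>
        |inner ℝ q.1 ((toWeakSpace ℝ E).symm z) - inner ℝ q.1 x| < 1 / ((N : ℝ) + 1))).2
        fun q _ => near q.1 _ hpos
      obtain ⟨z, hz, h1, h2, h3⟩ :=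
        (h.and_eventually (hall.and ((near x _ hpos).and self_mem_nhdsWithin))).exists
      exact ⟨((toWeakSpace ℝ E).symm z, N), ⟨⟨h3, hz⟩, h2⟩, fun q hq => ⟨hN q hq, h1 q hq⟩⟩)
  have hmono : StrictMono fun n => (f n).2 := fun m n hmn => (hfr m n hmn).1
  have hlim : Tendsto (fun n => 1 / (((f n).2 : ℝ) + 1)) atTop (𝓝 0) :=
    tendsto_one_div_add_atTop_nhds_zero_nat.comp hmono.tendsto_atTop
  have hx : Tendsto (fun n => inner ℝ x (f n).1) atTop (𝓝 (inner ℝ x x)) := by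
    rw [tendsto_iff_norm_sub_tendsto_zero]
    exact squeeze_zero (fun _ => norm_nonneg _) (fun n => (hf n).2.le) hlim
  have hm : ∀ m, Tendsto (fun n => inner ℝ (f m).1 (f n).1) atTop (𝓝 (inner ℝ (f m).1 x)) := by
    intro m
    rw [tendsto_iff_norm_sub_tendsto_zero]
    refine squeeze_zero' (.of_forall fun _ => norm_nonneg _) ?_ hlim
    filter_upwards [eventually_gt_atTop m] with n hn using (hfr m n hn).2.le
  refine ⟨fun n => (f n).1, fun n => (hf n).1, ?_⟩
  refine (isCompact_weakClosedBall r).tendsto_nhds_of_unique_mapClusterPt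
    (.of_forall fun n => (hf n).1.1) fun z _ hz => ?_
  have key : ∀ (v : E) (a : ℝ), Tendsto (fun n => inner ℝ v (f n).1) atTop (𝓝 a) →
      inner ℝ v ((toWeakSpace ℝ E).symm z) = a := by
    intro v a ha
    have := hz.continuousAt_comp (continuous_inner_toWeakSpace_symm v).continuousAt
    exact eq_of_nhds_neBot (this.clusterPt.neBot.mono (inf_le_inf_left _ ha))
  -- w is orthogonal to every point of the sequence, hence to the cluster point z; testing against x
  -- makes it orthogonal to x as well, so ⟪w, w⟫ = 0.
  set w := (toWeakSpace ℝ E).symm z - x with hw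
  have h1 : inner ℝ w ((toWeakSpace ℝ E).symm z) = 0 := by
    refine key w 0 (tendsto_const_nhds.congr fun m => ?_)
    rw [hw, inner_sub_left, real_inner_comm, key _ _ (hm m), real_inner_comm x, sub_self]
  have h2 : inner ℝ w x = 0 := by
    rw [hw, inner_sub_left, real_inner_comm, key _ _ hx, sub_self]
  have h3 : w = 0 := by
    rw [← inner_self_eq_zero (𝕜 := ℝ)]
    nth_rw 2 [hw]
    rw [inner_sub_right, h1, h2, sub_zero]
  rw [← (toWeakSpace ℝ E).apply_symm_apply z, sub_eq_zero.1 h3]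

/-- Sequences suffice on balls: a failure of semicontinuity occurs frequently near the point, hence
along a weakly convergent sequence. -/
theorem SeqWeaklyLowerSemicontinuousOn.lowerSemicontinuousOn [CompleteSpace E] {r : ℝ} {g : E → ℝ}
    (hg : SeqWeaklyLowerSemicontinuousOn g (Metric.closedBall (0 : E) r)) :
    LowerSemicontinuousOn (fun z => g ((toWeakSpace ℝ E).symm z)) (weakClosedBall E r) := by
  intro z hz c hc
  by_contra hcon
  obtain ⟨u, hu, hux⟩ := exists_weaklyTendsto_of_frequently (p := fun v => ¬ c < g v)
    (x := (toWeakSpace ℝ E).symm z) (r := r) (by simpa using hcon)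
  obtain ⟨n, hn⟩ := (hg u _ (fun n => (hu n).1) hz hux c hc).exists
  exact (hu n).2 hn

/-- Expanding ‖x − u n‖² ≥ 0 bounds ‖u n‖² below by 2⟪x, u n⟫ − ‖x‖², which tends to ‖x‖². -/
theorem WeaklyTendsto.eventually_lt_norm_sq {u : ℕ → E} {x : E} (h : WeaklyTendsto u x) {c : ℝ}
    (hc : c < ‖x‖ ^ 2) : ∀ᶠ n in atTop, c < ‖u n‖ ^ 2 := by
  have h1 : Tendsto (fun n => 2 * inner ℝ x (u n) - ‖x‖ ^ 2) atTop (𝓝 (‖x‖ ^ 2)) := by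
    have := ((h.tendsto_inner x).const_mul 2).sub_const (‖x‖ ^ 2)
    rw [real_inner_self_eq_norm_sq] at this
    convert this using 2
    ring
  filter_upwards [h1.eventually_const_lt hc] with n hn
  have h2 := norm_sub_sq_real x (u n)
  nlinarith [sq_nonneg ‖x - u n‖]

theorem SeqWeaklyLowerSemicontinuousOn.add {f g : E → ℝ} {X : Set E}
    (hf : SeqWeaklyLowerSemicontinuousOn f X) (hg : SeqWeaklyLowerSemicontinuousOn g X) :
    SeqWeaklyLowerSemicontinuousOn (fun x => f x + g x) X := by
  intro u x hu hx hux c hc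
  filter_upwards [hf u x hu hx hux (f x - (f x + g x - c) / 2) (by linarith),
    hg u x hu hx hux (g x - (f x + g x - c) / 2) (by linarith)] with n h1 h2
  linarith

theorem seqWeaklyLowerSemicontinuousOn_const_mul_norm_sq {a : ℝ} (ha : 0 ≤ a) (X : Set E) :
    SeqWeaklyLowerSemicontinuousOn (fun x => a * ‖x‖ ^ 2) X := by
  intro u x _ _ hux c hc
  rcases ha.eq_or_lt with rfl | ha
  · exact .of_forall fun n => by simpa using hc
  filter_upwards [hux.eventually_lt_norm_sq (c := c / a) (by rw [div_lt_iff₀ ha]; linarith)]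
    with n hn
  rw [div_lt_iff₀ ha] at hn
  linarith

variable {H : Type*} [NormedAddCommGroup H] [InnerProductSpace ℝ H]

theorem SeqWeaklyContinuous.seqWeaklyLowerSemicontinuousOn_inner {ψ : E → H}
    (hψ : SeqWeaklyContinuous ψ) (y : H) (X : Set E) :
    SeqWeaklyLowerSemicontinuousOn (fun x => inner ℝ (ψ x) y) X := by
  intro u x _ _ hux c hc
  simp only [real_inner_comm y] at hc ⊢
  exact ((hψ u x hux).tendsto_inner y).eventually_const_lt hc

end WeakTopology

/-! ### Minimax with unique minimizers. -/

section Minimax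

variable {X V : Type*} [TopologicalSpace X] [CompactSpace X] [Nonempty X]

theorem LowerSemicontinuous.exists_forall_ge {g : X → ℝ} (hg : LowerSemicontinuous g) :
    ∃ x, ∀ z, g x ≤ g z := by
  obtain ⟨x, -, hx⟩ := LowerSemicontinuousOn.exists_isMinOn Set.univ_nonempty isCompact_univ
    (hg.lowerSemicontinuousOn _)
  exact ⟨x, fun z => hx (Set.mem_univ z)⟩

variable [AddCommGroup V] [Module ℝ V] [TopologicalSpace V]

/-- A saddle point inequality: if `f` is lower semicontinuous in the first variable, concave and
continuous in the second one, and `f · y` has a unique minimizer for each `y` in the compact convex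
set `C`, then some `x` satisfies `f x y ≤ max_{y ∈ C} min_x f x y` for all `y ∈ C`. -/
theorem exists_forall_le_of_unique_minimizer_of_isCompact {C : Set V} (hC : IsCompact C)
    (hconv : Convex ℝ C) (hne : C.Nonempty) {f : X → V → ℝ}
    (hlsc : ∀ y ∈ C, LowerSemicontinuous fun x => f x y)
    (hcont : ∀ x, ContinuousOn (f x) C) (hconc : ∀ x, ConcaveOn ℝ C (f x))
    (huniq : ∀ y ∈ C, ∀ x₁ x₂, (∀ z, f x₁ y ≤ f z y) → (∀ z, f x₂ y ≤ f z y) → x₁ = x₂)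
    {c : ℝ} (hc : ∀ y ∈ C, ∃ x, f x y ≤ c) : ∃ x, ∀ y ∈ C, f x y ≤ c := by
  have hmin : ∀ y : V, ∃ x, y ∈ C → ∀ z, f x y ≤ f z y := fun y => by
    by_cases hy : y ∈ C
    · obtain ⟨x, hx⟩ := (hlsc y hy).exists_forall_ge
      exact ⟨x, fun _ => hx⟩
    · exact ⟨Classical.arbitrary X, fun h => absurd h hy⟩
  choose ξ hξ using hmin
  -- The minimal value is an infimum of functions continuous in y, so it attains its maximum on C,
  -- at y₀.
  have husc : UpperSemicontinuousOn (fun y => f (ξ y) y) C := by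
    intro y hy d hd
    filter_upwards [((hcont (ξ y)) y hy).eventually_lt_const hd, self_mem_nhdsWithin] with y' h1 h2
    exact (hξ y' h2 (ξ y)).trans_lt h1
  obtain ⟨y₀, hy₀, hmax⟩ := husc.exists_isMaxOn hne hC
  have hmc : f (ξ y₀) y₀ ≤ c := by
    obtain ⟨x, hx⟩ := hc y₀ hy₀
    exact (hξ y₀ hy₀ x).trans hx
  refine ⟨ξ y₀, fun y hy => le_trans ?_ hmc⟩
  set m := f (ξ y₀) y₀ with hm
  let t : ℕ → ℝ := fun n => 1 / ((n : ℝ) + 1)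
  have ht0 : ∀ n, 0 < t n := fun n => Nat.one_div_pos_of_nat
  have ht1 : ∀ n, t n ≤ 1 := fun n => by
    have : (0 : ℝ) ≤ n := n.cast_nonneg
    simp only [t]
    rw [div_le_one (by positivity)]
    linarith
  have htlim : Tendsto t atTop (𝓝 0) := tendsto_one_div_add_atTop_nhds_zero_nat
  -- Perturb y₀ towards y. Concavity and maximality at y₀ control the minimizers u n at w n, and
  -- their cluster points must minimize at y₀, where uniqueness applies.
  let w : ℕ → V := fun n => (1 - t n) • y₀ + t n • y
  have hw : ∀ n, w n ∈ C := fun n =>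
    hconv hy₀ hy (by linarith [ht1 n]) (ht0 n).le (by ring)
  let u : ℕ → X := fun n => ξ (w n)
  have hle : ∀ n, (1 - t n) * f (u n) y₀ + t n * f (u n) y ≤ m := fun n =>
    ((hconc (u n)).2 hy₀ hy (by linarith [ht1 n]) (ht0 n).le (by ring)).trans (hmax (hw n))
  have hu_y : ∀ n, f (u n) y ≤ m := by
    intro n
    have h1 := hξ y₀ hy₀ (u n)
    have h2 := mul_le_mul_of_nonneg_left h1 (sub_nonneg.2 (ht1 n))
    refine le_of_mul_le_mul_left ?_ (ht0 n)
    linarith [hle n]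
  obtain ⟨x, hx⟩ := exists_clusterPt_of_compactSpace (map u atTop)
  have hx : MapClusterPt x atTop u := hx
  have hxy : f x y ≤ m := by
    by_contra! hlt
    obtain ⟨n, hn⟩ := (hx.frequently (hlsc y hy x m hlt)).exists
    exact absurd (hu_y n) (not_le.2 hn)
  have hxy₀ : f x y₀ ≤ m := by
    by_contra! hlt
    obtain ⟨d, hmd, hdx⟩ := exists_between hlt
    -- f (u n) y is bounded below by f (ξ y) y, so its weight t n → 0 makes it negligible.
    have hlim : Tendsto (fun n => (1 - t n) * d + t n * f (ξ y) y) atTop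
        (𝓝 ((1 - 0) * d + 0 * f (ξ y) y)) :=
      ((tendsto_const_nhds.sub htlim).mul_const d).add (htlim.mul_const _)
    have hev : ∀ᶠ n in atTop, m < (1 - t n) * d + t n * f (ξ y) y :=
      hlim.eventually_const_lt (by linarith)
    obtain ⟨n, hn, hn'⟩ := ((hx.frequently (hlsc y₀ hy₀ x d hdx)).and_eventually hev).exists
    have h1 := mul_le_mul_of_nonneg_left hn.le (sub_nonneg.2 (ht1 n))
    have h2 := mul_le_mul_of_nonneg_left (hξ y hy (u n)) (ht0 n).le
    linarith [hle n]
  have : x = ξ y₀ := huniq y₀ hy₀ _ _ (fun z => hxy₀.trans (hξ y₀ hy₀ z)) (hξ y₀ hy₀)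
  rwa [← this]

/-- Ricceri's minimax theorem: if `f` is lower semicontinuous in the first variable on a compact
space, concave and continuous in the second one, and `f · y` has a unique minimizer for each `y` in
the convex set `Y`, then `inf_x sup_{y ∈ Y} f x y ≤ sup_{y ∈ Y} inf_x f x y`. -/
theorem exists_forall_le_of_unique_minimizer [IsTopologicalAddGroup V] [ContinuousSMul ℝ V]
    {Y : Set V} (hconv : Convex ℝ Y) {f : X → V → ℝ}
    (hlsc : ∀ y ∈ Y, LowerSemicontinuous fun x => f x y)
    (hcont : ∀ x, ContinuousOn (f x) Y) (hconc : ∀ x, ConcaveOn ℝ Y (f x))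
    (huniq : ∀ y ∈ Y, ∀ x₁ x₂, (∀ z, f x₁ y ≤ f z y) → (∀ z, f x₂ y ≤ f z y) → x₁ = x₂)
    {c : ℝ} (hc : ∀ y ∈ Y, ∃ x, f x y ≤ c) : ∃ x, ∀ y ∈ Y, f x y ≤ c := by
  have hfip : (⋂ y : Y, (fun x => f x y) ⁻¹' Set.Iic c).Nonempty := by
    -- Sublevel sets are closed; finitely many of them meet by the compact case on the convex hull
    -- of the parameters.
    refine CompactSpace.iInter_nonempty (fun y => (hlsc y y.2).isClosed_preimage c) fun F => ?_
    rcases F.eq_empty_or_nonempty with rfl | hF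
    · simp
    have hsub : convexHull ℝ ((fun y : Y => (y : V)) '' (F : Set Y)) ⊆ Y :=
      convexHull_min (by rintro _ ⟨y, -, rfl⟩; exact y.2) hconv
    obtain ⟨x, hx⟩ := exists_forall_le_of_unique_minimizer_of_isCompact
      ((F.finite_toSet.image _).isCompact_convexHull ℝ) (convex_convexHull ℝ _)
      ((Set.Nonempty.image _ hF).mono (subset_convexHull ℝ _))
      (fun y hy => hlsc y (hsub hy)) (fun x => (hcont x).mono hsub)
      (fun x => (hconc x).subset hsub (convex_convexHull ℝ _))
      (fun y hy => huniq y (hsub hy)) (fun y hy => hc y (hsub hy))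
    exact ⟨x, Set.mem_iInter₂.2 fun y hy =>
      hx y (subset_convexHull ℝ _ (Set.mem_image_of_mem _ hy))⟩
  obtain ⟨x, hx⟩ := hfip
  exact ⟨x, fun y hy => Set.mem_iInter.1 hx ⟨y, hy⟩⟩

end Minimax

/-! ### Constrained minimizers as critical points. -/

section Critical

variable {E : Type*} [NormedAddCommGroup E] [InnerProductSpace ℝ E] [CompleteSpace E]

/-- If `x` minimizes `z ↦ ‖z‖² / (2 a) - G z` over a convex set containing `a • ∇ G x`, then
`x = a • ∇ G x`. -/
theorem IsMinOn.eq_smul_gradient {K : Set E} (hK : Convex ℝ K) {a : ℝ} (ha : 0 < a) {G : E → ℝ}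
    {x : E} (hx : x ∈ K) (hG : DifferentiableAt ℝ G x)
    (hmin : IsMinOn (fun z => 1 / (2 * a) * ‖z‖ ^ 2 - G z) K x) (hmem : a • ∇ G x ∈ K) :
    x = a • ∇ G x := by
  have hd : HasFDerivAt (fun z => 1 / (2 * a) * ‖z‖ ^ 2 - G z)
      ((1 / (2 * a)) • (2 • innerSL ℝ x) - InnerProductSpace.toDual ℝ E (∇ G x)) x :=
    ((hasStrictFDerivAt_norm_sq x).hasFDerivAt.const_mul _).sub hG.hasGradientAt.hasFDerivAt
  have h := hmin.localize.hasFDerivWithinAt_nonneg hd.hasFDerivWithinAt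
    (sub_mem_posTangentConeAt_of_segment_subset (hK.segment_subset hx hmem))
  set g := ∇ G x
  have h1 : 0 ≤ 1 / a * inner ℝ x (a • g - x) - inner ℝ g (a • g - x) := by
    convert h using 1
    simp
    field_simp
  -- The first-order inequality in the admissible direction a • g − x is this one, up to the factor
  -- a.
  have h2 : 0 ≤ -‖x - a • g‖ ^ 2 := by
    have : a * (1 / a * inner ℝ x (a • g - x) - inner ℝ g (a • g - x)) = -‖x - a • g‖ ^ 2 := by
      rw [← real_inner_self_eq_norm_sq, ← neg_sub x (a • g), inner_neg_right, inner_neg_right,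
        inner_sub_left x, real_inner_smul_left]
      field_simp
      ring
    rw [← this]
    positivity
  have h3 : ‖x - a • g‖ = 0 := by
    nlinarith [sq_nonneg ‖x - a • g‖]
  exact sub_eq_zero.1 (norm_eq_zero.1 h3)

theorem gradient_add {f g : E → ℝ} {x : E} (hf : DifferentiableAt ℝ f x)
    (hg : DifferentiableAt ℝ g x) : ∇ (fun z => f z + g z) x = ∇ f x + ∇ g x :=
  (hasGradientAt_iff_hasFDerivAt.2 (by
    rw [map_add]
    exact hf.hasGradientAt.hasFDerivAt.add hg.hasGradientAt.hasFDerivAt)).gradient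

theorem norm_gradient_eq_norm_fderiv (f : E → ℝ) (x : E) : ‖∇ f x‖ = ‖fderiv ℝ f x‖ := by
  simp [gradient]

theorem norm_gradient_inner_le {H : Type*} [NormedAddCommGroup H] [InnerProductSpace ℝ H]
    {ψ : E → H} {x : E} (hψ : DifferentiableAt ℝ ψ x) (y : H) :
    ‖∇ (fun z => inner ℝ (ψ z) y) x‖ ≤ ‖y‖ * ‖fderiv ℝ ψ x‖ := by
  have h : HasFDerivAt (fun z => inner ℝ (ψ z) y) ((innerSL ℝ y).comp (fderiv ℝ ψ x)) x := by
    simp only [real_inner_comm y]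
    exact (innerSL ℝ y).hasFDerivAt.comp x hψ.hasFDerivAt
  rw [norm_gradient_eq_norm_fderiv, h.fderiv]
  exact (ContinuousLinearMap.opNorm_comp_le _ _).trans_eq (by rw [innerSL_apply_norm])

/-- Mean value inequality; boundedness makes the real `sSup` and `sInf` of γ genuine bounds rather
than default values. -/
theorem exists_abs_le_of_norm_gradient_le {γ : E → ℝ} (hγ : Differentiable ℝ γ) {r M : ℝ}
    (hM : ∀ x ∈ Metric.closedBall (0 : E) r, ‖∇ γ x‖ ≤ M) (hr : 0 ≤ r) :
    ∃ C, ∀ x ∈ Metric.closedBall (0 : E) r, |γ x| ≤ C := by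
  refine ⟨|γ 0| + M * r, fun x hx => ?_⟩
  have h0 : (0 : E) ∈ Metric.closedBall (0 : E) r := by simpa using hr
  have h := (convex_closedBall (0 : E) r).norm_image_sub_le_of_norm_fderiv_le (𝕜 := ℝ)
    (fun z _ => hγ z) (fun z hz => (norm_gradient_eq_norm_fderiv γ z).symm.trans_le (hM z hz)) h0 hx
  have hM0 : 0 ≤ M := (norm_nonneg _).trans (hM 0 h0)
  rw [sub_zero, Real.norm_eq_abs] at h
  have h2 := mul_le_mul_of_nonneg_left (mem_closedBall_zero_iff.1 hx) hM0
  have h3 := abs_sub_abs_le_abs_sub (γ x) (γ 0)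
  linarith

end Critical

theorem exists_norm_le_inner_eq_mul_norm {H : Type*} [NormedAddCommGroup H] [InnerProductSpace ℝ H]
    (v : H) {s : ℝ} (hs : 0 ≤ s) : ∃ y : H, ‖y‖ ≤ s ∧ inner ℝ v y = s * ‖v‖ := by
  rcases eq_or_ne v 0 with rfl | hv
  · exact ⟨0, by simpa using hs, by simp⟩
  have hv' : ‖v‖ ≠ 0 := norm_ne_zero_iff.2 hv
  refine ⟨(s / ‖v‖) • v, ?_, ?_⟩
  · rw [norm_smul, norm_div, norm_norm, div_mul_cancel₀ _ hv', Real.norm_of_nonneg hs]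
  · rw [real_inner_smul_right, real_inner_self_eq_norm_sq]
    field_simp

/-! ### Minimax for functionals on the weak ball. -/

section

variable {E : Type*} [NormedAddCommGroup E] [InnerProductSpace ℝ E]
  {H : Type*} [NormedAddCommGroup H] [InnerProductSpace ℝ H]

/-- s‖ψ‖ is the supremum of ⟪ψ, y⟫ over ‖y‖ ≤ s; a y norming ψ at the weak limit suffices. -/
theorem SeqWeaklyLowerSemicontinuousOn.add_const_mul_norm {I : E → ℝ} {X : Set E}
    (hI : SeqWeaklyLowerSemicontinuousOn I X) {ψ : E → H} (hψ : SeqWeaklyContinuous ψ) {s : ℝ}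
    (hs : 0 ≤ s) : SeqWeaklyLowerSemicontinuousOn (fun x => I x + s * ‖ψ x‖) X := by
  intro u x hu hx hux c hc
  obtain ⟨y, hys, hy⟩ := exists_norm_le_inner_eq_mul_norm (ψ x) hs
  filter_upwards [hI.add (hψ.seqWeaklyLowerSemicontinuousOn_inner y X) u x hu hx hux c
    (by simpa only [hy] using hc)] with n hn
  have h1 := real_inner_le_norm (ψ (u n)) y
  have h2 := mul_le_mul_of_nonneg_left hys (norm_nonneg (ψ (u n)))
  linarith

variable [CompleteSpace E]

theorem SeqWeaklyLowerSemicontinuousOn.exists_isMinOn {r : ℝ} (hr : 0 ≤ r) {g : E → ℝ}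
    (hg : SeqWeaklyLowerSemicontinuousOn g (Metric.closedBall (0 : E) r)) :
    ∃ x ∈ Metric.closedBall (0 : E) r, IsMinOn g (Metric.closedBall (0 : E) r) x := by
  obtain ⟨z, hz, hmin⟩ := hg.lowerSemicontinuousOn.exists_isMinOn
    ⟨toWeakSpace ℝ E 0, by simpa [weakClosedBall] using hr⟩ (isCompact_weakClosedBall r)
  exact ⟨(toWeakSpace ℝ E).symm z, hz, fun x hx =>
    hmin (show toWeakSpace ℝ E x ∈ weakClosedBall E r by simpa [weakClosedBall] using hx)⟩

/-- If for each `y` in a dense convex subset of the ball of radius `s` the functional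
`J - ⟪ψ ·, y⟫` takes a value `≤ c` on the ball but has at most one global minimizer there, then
`J + s ‖ψ ·‖` takes a value `≤ c` on the ball. -/
theorem exists_add_mul_norm_le_of_unique_minimizer {r s : ℝ} (hr : 0 ≤ r) (hs : 0 < s) {J : E → ℝ}
    (hJ : SeqWeaklyLowerSemicontinuousOn J (Metric.closedBall (0 : E) r)) {ψ : E → H}
    (hψ : SeqWeaklyContinuous ψ) {S : Set H} (hS : Convex ℝ S) (hSd : Dense S) {c : ℝ}
    (hc : ∀ y : H, ∃ x ∈ Metric.closedBall (0 : E) r, J x - inner ℝ (ψ x) y ≤ c)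
    (huniq : ∀ y ∈ S, ‖y‖ < s → ∀ x₁ ∈ Metric.closedBall (0 : E) r,
      ∀ x₂ ∈ Metric.closedBall (0 : E) r,
      IsMinOn (fun x => J x - inner ℝ (ψ x) y) (Metric.closedBall (0 : E) r) x₁ →
      IsMinOn (fun x => J x - inner ℝ (ψ x) y) (Metric.closedBall (0 : E) r) x₂ → x₁ = x₂) :
    ∃ x ∈ Metric.closedBall (0 : E) r, J x + s * ‖ψ x‖ ≤ c := by
  have hmem : ∀ {x : E}, x ∈ Metric.closedBall (0 : E) r → toWeakSpace ℝ E x ∈ weakClosedBall E r :=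
    fun hx => by simpa [weakClosedBall] using hx
  have : CompactSpace (weakClosedBall E r) :=
    isCompact_iff_compactSpace.1 (isCompact_weakClosedBall r)
  have : Nonempty (weakClosedBall E r) := ⟨⟨_, hmem (Metric.mem_closedBall_self hr)⟩⟩
  obtain ⟨x, hx⟩ := exists_forall_le_of_unique_minimizer (X := weakClosedBall E r)
    (Y := Metric.ball (0 : H) s ∩ S) ((convex_ball 0 s).inter hS)
    (f := fun x y => J ((toWeakSpace ℝ E).symm x) - inner ℝ (ψ ((toWeakSpace ℝ E).symm x)) y)
    (c := c)
    (fun y _ => by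
      have h := (hJ.add (hψ.seqWeaklyLowerSemicontinuousOn_inner (-y) _)).lowerSemicontinuousOn
      simp only [inner_neg_right, ← sub_eq_add_neg] at h
      exact lowerSemicontinuous_restrict_iff.2 h)
    (fun x => by fun_prop)
    (fun x => ⟨(convex_ball 0 s).inter hS, fun y _ z _ a b _ _ hab => by
      simp only [inner_add_right, real_inner_smul_right, smul_eq_mul]
      exact le_of_eq (by linear_combination J ((toWeakSpace ℝ E).symm x) * hab)⟩)
    (fun y hy x₁ x₂ h₁ h₂ => Subtype.ext <| (toWeakSpace ℝ E).symm.injective <|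
      huniq y hy.2 (by simpa using hy.1) _ x₁.2 _ x₂.2
        (fun z hz => h₁ ⟨toWeakSpace ℝ E z, hmem hz⟩)
        (fun z hz => h₂ ⟨toWeakSpace ℝ E z, hmem hz⟩))
    (fun y _ => by
      obtain ⟨x, hx, hxc⟩ := hc y
      exact ⟨⟨toWeakSpace ℝ E x, hmem hx⟩, by simpa using hxc⟩)
  obtain ⟨y, hys, hy⟩ := exists_norm_le_inner_eq_mul_norm (ψ ((toWeakSpace ℝ E).symm x)) hs.le
  refine ⟨(toWeakSpace ℝ E).symm x, x.2, ?_⟩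
  -- Density and continuity in y extend the bound to the closed ball, where −y, with y norming ψ x,
  -- turns −⟪ψ x, ·⟫ into s‖ψ x‖.
  have hcl : Metric.closedBall (0 : H) s ⊆ closure (Metric.ball (0 : H) s ∩ S) := by
    rw [← closure_ball (0 : H) hs.ne']
    exact closure_minimal (hSd.open_subset_closure_inter Metric.isOpen_ball) isClosed_closure
  have hclosed : IsClosed {y : H | J ((toWeakSpace ℝ E).symm x) -
      inner ℝ (ψ ((toWeakSpace ℝ E).symm x)) y ≤ c} :=
    isClosed_le (by fun_prop) continuous_const
  have hle : J ((toWeakSpace ℝ E).symm x) - inner ℝ (ψ ((toWeakSpace ℝ E).symm x)) (-y) ≤ c :=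
    closure_minimal hx hclosed (hcl (show -y ∈ Metric.closedBall (0 : H) s by simpa using hys))
  rw [inner_neg_right, hy] at hle
  linarith

end

theorem mul_norm_gradient_le_of_ofReal_le {E H : Type*} [NormedAddCommGroup E]
    [InnerProductSpace ℝ E] [CompleteSpace E] [NormedAddCommGroup H] [InnerProductSpace ℝ H]
    {r s M lam : ℝ} (hr : 0 ≤ r) (hs : 0 ≤ s) (hM : 0 ≤ M) (hlam : 0 ≤ lam)
    {P : E → ℝ} {ψ : E → H}
    (h : ENNReal.ofReal lam ≤ ENNReal.ofReal r /
      ((⨆ x ∈ Metric.closedBall (0 : E) r,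
        (‖∇ P x‖ₑ + ENNReal.ofReal s * ‖fderiv ℝ ψ x‖ₑ)) + ENNReal.ofReal M))
    {x : E} (hx : x ∈ Metric.closedBall (0 : E) r) :
    lam * (‖∇ P x‖ + s * ‖fderiv ℝ ψ x‖ + M) ≤ r := by
  have h1 := ENNReal.mul_le_of_le_div h
  have h2 : ENNReal.ofReal (‖∇ P x‖ + s * ‖fderiv ℝ ψ x‖ + M) ≤
      (⨆ x ∈ Metric.closedBall (0 : E) r,
        (‖∇ P x‖ₑ + ENNReal.ofReal s * ‖fderiv ℝ ψ x‖ₑ)) + ENNReal.ofReal M := by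
    rw [ENNReal.ofReal_add (by positivity) hM, ENNReal.ofReal_add (by positivity) (by positivity),
      ENNReal.ofReal_mul hs, ofReal_norm, ofReal_norm]
    gcongr
    exact le_iSup₂ (f := fun x (_ : x ∈ Metric.closedBall (0 : E) r) =>
      ‖∇ P x‖ₑ + ENNReal.ofReal s * ‖fderiv ℝ ψ x‖ₑ) x hx
  rw [← ENNReal.ofReal_le_ofReal_iff hr, ENNReal.ofReal_mul hlam]
  exact (mul_le_mul_right h2 _).trans h1

/-! ### The main theorem. -/

theorem theorem2p3
    {E : Type*} [NormedAddCommGroup E] [InnerProductSpace ℝ E] [CompleteSpace E]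
    {H : Type*} [NormedAddCommGroup H] [InnerProductSpace ℝ H] [CompleteSpace H]
    (r s σ : ℝ) (hr : 0 < r) (hs : 0 < s) (hσ : 0 < σ)
    (P : E → ℝ) (hP : ContDiff ℝ 1 P) (hPeven : Function.Even P)
    (hPlsc : SeqWeaklyLowerSemicontinuousOn (fun x => σ * ‖x‖ ^ 2 - P x)
      (Metric.closedBall (0 : E) r))
    (ψ : E → H) (hψ : ContDiff ℝ 1 ψ) (hψodd : Function.Odd ψ) (hψw : SeqWeaklyContinuous ψ)
    (M : ℝ) (hM : 0 ≤ M)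
    (lam : ℝ) (hlam : 0 < lam)
    -- the upper bound on `lam`, in `[0, ∞]`, so that the supremum may be infinite
    (hlam' : ENNReal.ofReal lam ≤
      min (ENNReal.ofReal r /
            ((⨆ x ∈ Metric.closedBall (0 : E) r,
                (‖∇ P x‖ₑ + ENNReal.ofReal s * ‖fderiv ℝ ψ x‖ₑ)) + ENNReal.ofReal M))
          (ENNReal.ofReal (1 / (2 * σ))))
    (hmin : ¬ ∃ x ∈ Metric.closedBall (0 : E) r,
      IsMinOn (fun z => 1 / (2 * lam) * ‖z‖ ^ 2 - P z) (Metric.closedBall (0 : E) r) x ∧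
        ψ x = 0) :
    ∃ δ : ℝ, 0 < δ ∧
      ∀ S : Set H, Convex ℝ S → Dense S →
      ∀ γ : E → ℝ, ContDiff ℝ 1 γ →
        sSup (γ '' Metric.closedBall (0 : E) r) - sInf (γ '' Metric.closedBall (0 : E) r) < δ →
        (∀ x ∈ Metric.closedBall (0 : E) r, ‖∇ γ x‖ ≤ M) →
        SeqWeaklyLowerSemicontinuousOn (fun x => σ * ‖x‖ ^ 2 - P x - γ x)
          (Metric.closedBall (0 : E) r) →
        ∃ y ∈ S, ‖y‖ < s ∧
          ∃ x₁ ∈ Metric.closedBall (0 : E) r, ∃ x₂ ∈ Metric.closedBall (0 : E) r, x₁ ≠ x₂ ∧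
            x₁ = lam • (∇ P x₁ + ∇ γ x₁ + ∇ (fun z => inner ℝ (ψ z) y) x₁) ∧
            x₂ = lam • (∇ P x₂ + ∇ γ x₂ + ∇ (fun z => inner ℝ (ψ z) y) x₂) := by
  rw [le_min_iff] at hlam'
  obtain ⟨hlam_r, hlam_σ⟩ := hlam'
  have hσlam : σ ≤ 1 / (2 * lam) := by
    rw [ENNReal.ofReal_le_ofReal_iff (by positivity), le_div_iff₀ (by positivity)] at hlam_σ
    rw [le_div_iff₀ (by positivity)]
    linarith
  have hI : SeqWeaklyLowerSemicontinuousOn (fun z => 1 / (2 * lam) * ‖z‖ ^ 2 - P z)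
      (Metric.closedBall (0 : E) r) := by
    convert! hPlsc.add (seqWeaklyLowerSemicontinuousOn_const_mul_norm_sq (sub_nonneg.2 hσlam) _)
      using 2
    ring
  obtain ⟨x₀, hx₀, hx₀min⟩ := hI.exists_isMinOn hr.le
  obtain ⟨x₁, hx₁, hx₁min⟩ := (hI.add_const_mul_norm hψw hs.le).exists_isMinOn hr.le
  rw [isMinOn_iff] at hx₀min hx₁min
  -- δ is min(I + s‖ψ‖) − min I; were it not positive, x₁ would minimize I with ψ x₁ = 0.
  refine ⟨1 / (2 * lam) * ‖x₁‖ ^ 2 - P x₁ + s * ‖ψ x₁‖ - (1 / (2 * lam) * ‖x₀‖ ^ 2 - P x₀),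
    ?_, ?_⟩
  · by_contra! hle
    have h01 := hx₀min x₁ hx₁
    have hs1 : 0 ≤ s * ‖ψ x₁‖ := by positivity
    refine hmin ⟨x₁, hx₁, fun z hz => ?_, ?_⟩
    · have := hx₀min z hz
      change 1 / (2 * lam) * ‖x₁‖ ^ 2 - P x₁ ≤ 1 / (2 * lam) * ‖z‖ ^ 2 - P z
      linarith
    · have : s * ‖ψ x₁‖ = 0 := by linarith
      simpa [hs.ne'] using this
  intro S hS hSd γ hγ hosc hγM hγlsc
  have hγd : Differentiable ℝ γ := hγ.differentiable one_ne_zero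
  have hPd : Differentiable ℝ P := hP.differentiable one_ne_zero
  have hψd : Differentiable ℝ ψ := hψ.differentiable one_ne_zero
  obtain ⟨C, hC⟩ := exists_abs_le_of_norm_gradient_le hγd hγM hr.le
  have hsup : ∀ x ∈ Metric.closedBall (0 : E) r, γ x ≤ sSup (γ '' Metric.closedBall (0 : E) r) :=
    fun x hx => le_csSup ⟨C, by rintro _ ⟨z, hz, rfl⟩; exact (abs_le.1 (hC z hz)).2⟩
      (Set.mem_image_of_mem _ hx)
  have hinf : ∀ x ∈ Metric.closedBall (0 : E) r, sInf (γ '' Metric.closedBall (0 : E) r) ≤ γ x :=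
    fun x hx => csInf_le ⟨-C, by rintro _ ⟨z, hz, rfl⟩; exact (abs_le.1 (hC z hz)).1⟩
      (Set.mem_image_of_mem _ hx)
  have hJ : SeqWeaklyLowerSemicontinuousOn (fun z => 1 / (2 * lam) * ‖z‖ ^ 2 - P z - γ z)
      (Metric.closedBall (0 : E) r) := by
    convert! hγlsc.add (seqWeaklyLowerSemicontinuousOn_const_mul_norm_sq (sub_nonneg.2 hσlam) _)
      using 2
    ring
  have hcrit : ∀ y : H, ‖y‖ < s → ∀ x ∈ Metric.closedBall (0 : E) r,
      IsMinOn (fun z => 1 / (2 * lam) * ‖z‖ ^ 2 - P z - γ z - inner ℝ (ψ z) y)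
        (Metric.closedBall (0 : E) r) x →
      x = lam • (∇ P x + ∇ γ x + ∇ (fun z => inner ℝ (ψ z) y) x) := by
    intro y hy x hx hxmin
    have hψy : DifferentiableAt ℝ (fun z => inner ℝ (ψ z) y) x :=
      (hψd x).inner ℝ (differentiableAt_const y)
    have hgrad : ∇ (fun z => P z + γ z + inner ℝ (ψ z) y) x =
        ∇ P x + ∇ γ x + ∇ (fun z => inner ℝ (ψ z) y) x := by
      rw [gradient_add (f := fun z => P z + γ z) ((hPd x).add (hγd x)) hψy, gradient_add (hPd x) (hγd x)]
    rw [← hgrad]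
    refine IsMinOn.eq_smul_gradient (convex_closedBall (0 : E) r) hlam hx
      (((hPd x).add (hγd x)).add hψy) ?_ ?_
    · convert! hxmin using 2
      ring
    · rw [hgrad, mem_closedBall_zero_iff, norm_smul, Real.norm_of_nonneg hlam.le]
      refine le_trans (mul_le_mul_of_nonneg_left ?_ hlam.le)
        (mul_norm_gradient_le_of_ofReal_le hr.le hs.le hM hlam.le hlam_r hx)
      have h1 := norm_add₃_le (a := ∇ P x) (b := ∇ γ x) (c := ∇ (fun z => inner ℝ (ψ z) y) x)
      have h2 := norm_gradient_inner_le (hψd x) y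
      have h3 := mul_le_mul_of_nonneg_right hy.le (norm_nonneg (fderiv ℝ ψ x))
      linarith [hγM x hx]
  by_contra hcon
  obtain ⟨x, hx, hxle⟩ := exists_add_mul_norm_le_of_unique_minimizer hr.le hs hJ hψw hS hSd
    (c := 1 / (2 * lam) * ‖x₀‖ ^ 2 - P x₀ - sInf (γ '' Metric.closedBall (0 : E) r))
    -- Symmetry: choose the sign of ±x₀ making ⟪ψ, y⟫ nonnegative; I is the same at both, and γ ≥
    -- inf γ.
    (fun y => by
      rcases le_total 0 (inner ℝ (ψ x₀) y) with h | h
      · exact ⟨x₀, hx₀, by linarith [hinf x₀ hx₀]⟩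
      · have hneg : -x₀ ∈ Metric.closedBall (0 : E) r := by simpa using hx₀
        refine ⟨-x₀, hneg, ?_⟩
        rw [norm_neg, hPeven, hψodd, inner_neg_left]
        linarith [hinf _ hneg])
    (fun y hyS hys z₁ hz₁ z₂ hz₂ hm₁ hm₂ => by
      by_contra hne
      exact hcon ⟨y, hyS, hys, z₁, hz₁, z₂, hz₂, hne, hcrit y hys z₁ hz₁ hm₁,
        hcrit y hys z₂ hz₂ hm₂⟩)
  -- At x the two bounds give δ ≤ sup γ − inf γ, contradicting `hosc`.
  linarith [hx₁min x hx, hsup x hx]
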